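/- Let $\mathscr H,\mathscr K$ be complex Hilbert spaces. Let $f:(0,\infty)\to(0,\infty)$ be an operator monotone function, that is, $f$ is continuous and $f(X)\le f(Y)$ whenever $0<X\le Y$ are bounded operators on a complex Hilbert space ($X>0$ means positive and invertible, and $\le$ is the Loewner order). For $A,B>0$ let $$A\,\sigma\,B=A^{1/2}f\bigl(A^{-1/2}BA^{-1/2}\bigr)A^{1/2}$$ be the Kubo--Ando operator mean with representing function $f$. **Theorem.** Let $\Phi:\mathbb B(\mathscr H)\to\mathbb B(\mathscr K)$ be a unital positive linear map, let $0<m_1\le M_1$ and $0<m_2\le M_2$ be real numbers, not both $m_1=M_1$ and $m_2=M_2$, and let $A,B\in\mathbb B(\mathscr H)$ satisfy $m_1^2\le A\le M_1^2$ and $m_2^2\le B\le M_2^2$. Put $a=m_2^2/M_1^2$, $b=M_2^2/m_1^2$, $$\mu_f=\frac{f(b)-f(a)}{b-a},\qquad \nu_f=\frac{b f(a)-a f(b)}{b-a},$$ $$m=m_1^2 f(m_2^2/m_1^2),\qquad M=M_1^2 f(M_2^2/M_1^2).$$ Then the maxima $$\alpha=\max_{a\le t\le b}\frac{f(t)}{\mu_f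 t+\nu_f},\qquad \beta=\max_{m\le t\le M}\frac{\alpha (M+m)t-mM}{t^2}$$ exist, and $$\bigl(\Phi(A)\,\sigma\,\Phi(B)\bigr)^2\le \beta\,\Phi(A\,\sigma\,B)^2 .$$ -/

import Mathlib

universe u

/-- `f` is a positive operator monotone function on `(0, ∞)`: it is continuous and positive there,
and `0 < A ≤ B` implies `f(A) ≤ f(B)` for bounded operators `A, B` on every complex Hilbert space,
where `f(A)` is the continuous functional calculus and `≤` is the Loewner order. -/
structure IsPositiveOperatorMonotone (f : ℝ → ℝ) : Prop where
  continuousOn : ContinuousOn f (Set.Ioi 0)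
  pos : ∀ t : ℝ, 0 < t → 0 < f t
  monotone : ∀ (H : Type u) [NormedAddCommGroup H] [InnerProductSpace ℂ H] [CompleteSpace H]
    (A B : H →L[ℂ] H), IsStrictlyPositive A → A ≤ B → cfc f A ≤ cfc f B

/-- The Kubo-Ando operator mean with representing function `f`, for strictly positive operators:
`A σ B = A^{1/2} f(A^{-1/2} B A^{-1/2}) A^{1/2}`. -/
noncomputable def operatorMean {H : Type*} [NormedAddCommGroup H] [InnerProductSpace ℂ H]
    [CompleteSpace H] (f : ℝ → ℝ) (A B : H →L[ℂ] H) : H →L[ℂ] H :=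
  A ^ (1 / 2 : ℝ) * cfc f (A ^ (-1 / 2 : ℝ) * B * A ^ (-1 / 2 : ℝ)) * A ^ (1 / 2 : ℝ)

/-- Slope of the chord of `f` over `[a, b]`. -/
noncomputable def chordSlope (f : ℝ → ℝ) (a b : ℝ) : ℝ := (f b - f a) / (b - a)

/-- Intercept of the chord of `f` over `[a, b]`. -/
noncomputable def chordIntercept (f : ℝ → ℝ) (a b : ℝ) : ℝ := (b * f a - a * f b) / (b - a)

/-- The function `t ↦ f(t) / (μ_f t + ν_f)` on `[a, b]`. -/
noncomputable def chordRatio (f : ℝ → ℝ) (a b t : ℝ) : ℝ :=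
  f t / (chordSlope f a b * t + chordIntercept f a b)

/-- The rational function `t ↦ (α (M + m) t - m M) / t²`. -/
noncomputable def squaringRatio (α m M t : ℝ) : ℝ := (α * (M + m) * t - m * M) / t ^ 2

/-!
The proof uses only two facts about a positive operator monotone function `f`: it is increasing and
concave as a function of a real variable.

Concavity (`IsPositiveOperatorMonotone.concaveOn`) needs only operators on a space of dimension two.
Let `p`, `v` be projections onto lines with `p v p = s p`, and put `t = a v + b (1 - v)`. Then
`p t p = (s a + (1 - s) b) p`, and `t` is dominated by a combination of `p` and `1 - p` whose
coefficient at `p` is `(1 + δ) (s a + (1 - s) b)`, the coefficient at `1 - p` being large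
(`le_smul_pinching`). Applying `f` and compressing to the range of `p` gives
`s f(a) + (1 - s) f(b) ≤ f((1 + δ) (s a + (1 - s) b))`; let `δ → 0`. Positivity and concavity on the
half-line make `f(x) / x` decreasing, that is, `t ↦ t f(c / t)` increasing.

Concavity puts `f` above its chord on `[a, b]`, so `μ B + ν A ≤ A σ B`, while by definition of `α`
it lies below `α` times its chord, so `Φ(A) σ Φ(B) ≤ α (μ Φ(B) + ν Φ(A)) ≤ α Φ(A σ B)`.
Monotonicity in the second variable reduces bounds on the mean to `A σ c = A f(c A⁻¹)`, and since
`t f(c / t)` is increasing, both `P = Φ(A) σ Φ(B)` and `Q = Φ(A σ B)` lie between `m` and `M`. Hence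
`P² ≤ (M + m) P - m M ≤ α (M + m) Q - m M ≤ β Q²` (`sq_le_smul_sq`).
-/

/-! ### Combinations of a projection and its complement -/

section StarProjection

variable {R : Type*} [CStarAlgebra R]

/-- A function of an operator with spectral projections `p` and `1 - p` is computed
on its two eigenvalues. -/
theorem cfc_smul_add_smul_one_sub {p : R} (hp : IsStarProjection p) (f : ℝ → ℝ) (a b : ℝ) :
    cfc f (a • p + b • (1 - p)) = f a • p + f b • (1 - p) := by
  have hsa : IsSelfAdjoint p := hp.isSelfAdjoint
  have hspec : spectrum ℝ p ⊆ {0, 1} := hp.isIdempotentElem.spectrum_subset ℝ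
  have hfin : (spectrum ℝ p).Finite := hp.isIdempotentElem.finite_spectrum ℝ
  have haff (c d : ℝ) : cfc (fun x : ℝ => d + (c - d) * x) p = c • p + d • (1 - p) := by
    rw [cfc_const_add .., cfc_const_mul_id .., Algebra.algebraMap_eq_smul_one]
    module
  have hcomp := cfc_comp' f (fun x : ℝ => b + (a - b) * x) p
    ((hfin.image _).continuousOn _)
  rw [haff] at hcomp
  rw [← hcomp, ← haff]
  -- Both sides are now functions of `p`, whose spectrum is contained in `{0, 1}`.
  refine cfc_congr fun x hx => ?_
  rcases hspec hx with rfl | rfl <;> simp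

variable [PartialOrder R] [StarOrderedRing R]

/-- Up to a factor on each diagonal block, a positive operator is dominated by its pinching:
the off-diagonal blocks are absorbed because `(δ p - (1 - p)) t (δ p - (1 - p)) ≥ 0`. -/
theorem le_smul_pinching {t p : R} (ht : 0 ≤ t) (hp : IsStarProjection p) {δ : ℝ} (hδ : 0 < δ) :
    t ≤ (1 + δ) • (p * t * p) + (1 + δ⁻¹) • ((1 - p) * t * (1 - p)) := by
  have hsa : IsSelfAdjoint (δ • p - (1 - p)) :=
    ((IsSelfAdjoint.all δ).smul hp.isSelfAdjoint).sub
      ((IsSelfAdjoint.one R).sub hp.isSelfAdjoint)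
  have h := smul_nonneg (inv_nonneg.2 hδ.le) (hsa.conjugate_nonneg ht)
  rw [← sub_nonneg]
  convert h using 1
  simp only [sub_mul, mul_sub, smul_mul_assoc, mul_smul_comm, one_mul, mul_one, smul_sub,
    smul_smul, add_smul, inv_mul_cancel₀ hδ.ne', one_smul]
  simp only [← mul_assoc, inv_mul_cancel₀ hδ.ne', one_mul]
  abel

theorem le_of_smul_le_smul_of_nonneg_of_ne_zero {p : R} (hp : 0 ≤ p) (hp0 : p ≠ 0) {r t : ℝ}
    (h : r • p ≤ t • p) : r ≤ t := by
  by_contra! hlt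
  have h1 : (r - t) • p ≤ 0 := by rwa [sub_smul, sub_nonpos]
  have h2 : (r - t) • p = 0 := le_antisymm h1 (smul_nonneg (sub_nonneg.2 hlt.le) hp)
  exact (smul_eq_zero.1 h2).elim (sub_pos.2 hlt).ne' hp0

theorem isStrictlyPositive_of_smul_one_le {x : R} {c : ℝ} (hc : 0 < c)
    (h : c • (1 : R) ≤ x) : IsStrictlyPositive x := by
  have h1 : IsStrictlyPositive (c • (1 : R)) :=
    IsStrictlyPositive.smul hc isStrictlyPositive_one
  exact h1.of_le h

/-- The value of `f` at a mean dominates the mean of the values, up to the factor `1 + δ` in the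
argument: bound `t = a v + b (1 - v)` by a combination of `p` and `1 - p`, apply `f`, and compress
to the range of `p`. -/
theorem combo_le_apply_mul_of_cfc_monotone {f : ℝ → ℝ}
    (hf : ∀ x y : R, IsStrictlyPositive x → x ≤ y → cfc f x ≤ cfc f y) {p v : R}
    (hp : IsStarProjection p) (hv : IsStarProjection v) (hp0 : p ≠ 0) {a b s δ : ℝ} (ha : 0 < a)
    (hb : 0 < b) (hpv : p * v * p = (s : ℂ) • p) (hδ : 0 < δ) :
    s * f a + (1 - s) * f b ≤ f ((1 + δ) * (s * a + (1 - s) * b)) := by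
  rw [Complex.coe_smul] at hpv
  have hpp : p * p = p := hp.isIdempotentElem
  set t := a • v + b • (1 - v) with ht
  have hcomp (c d : ℝ) : p * (c • v + d • (1 - v)) * p = (s * c + (1 - s) * d) • p := by
    simp only [mul_add, add_mul, mul_sub, sub_mul, mul_smul_comm, smul_mul_assoc, mul_one, hpp, hpv]
    module
  have hv1 : 0 ≤ 1 - v := hv.one_sub.nonneg
  have hmin : min a b • (1 : R) ≤ t := by
    have h1 := smul_le_smul_of_nonneg_right (min_le_left a b) hv.nonneg
    have h2 := smul_le_smul_of_nonneg_right (min_le_right a b) hv1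
    calc min a b • (1 : R) = min a b • v + min a b • (1 - v) := by module
      _ ≤ t := add_le_add h1 h2
  have hmax : t ≤ max a b • 1 := by
    have h1 := smul_le_smul_of_nonneg_right (le_max_left a b) hv.nonneg
    have h2 := smul_le_smul_of_nonneg_right (le_max_right a b) hv1
    calc t ≤ max a b • v + max a b • (1 - v) := add_le_add h1 h2
      _ = max a b • (1 : R) := by module
  have htpos : IsStrictlyPositive t := isStrictlyPositive_of_smul_one_le (lt_min ha hb) hmin
  have hq : (1 - p) * t * (1 - p) ≤ max a b • (1 - p) := by
    have h := hp.one_sub.isSelfAdjoint.conjugate_le_conjugate hmax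
    rwa [mul_smul_comm, mul_one, smul_mul_assoc, hp.one_sub.isIdempotentElem] at h
  have hle : t ≤ ((1 + δ) * (s * a + (1 - s) * b)) • p +
      ((1 + δ⁻¹) * max a b) • (1 - p) := by
    refine (le_smul_pinching htpos.nonneg hp hδ).trans ?_
    rw [hcomp, smul_smul, mul_smul (1 + δ⁻¹)]
    gcongr
  have h := hp.isSelfAdjoint.conjugate_le_conjugate (hf _ _ htpos hle)
  rw [ht, cfc_smul_add_smul_one_sub hv, cfc_smul_add_smul_one_sub hp, hcomp] at h
  refine le_of_smul_le_smul_of_nonneg_of_ne_zero hp.nonneg hp0 (h.trans_eq ?_)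
  simp only [mul_add, add_mul, mul_sub, sub_mul, mul_smul_comm, smul_mul_assoc, mul_one, hpp,
    sub_self, smul_zero, add_zero]

theorem le_of_cfc_monotone [Nontrivial R] {f : ℝ → ℝ}
    (hf : ∀ x y : R, IsStrictlyPositive x → x ≤ y → cfc f x ≤ cfc f y) {s t : ℝ} (hs : 0 < s)
    (hst : s ≤ t) : f s ≤ f t := by
  have h := hf (algebraMap ℝ R s) (algebraMap ℝ R t)
    (isStrictlyPositive_of_smul_one_le hs (Algebra.algebraMap_eq_smul_one _).ge)
    (algebraMap_mono _ hst)
  rw [cfc_algebraMap, cfc_algebraMap, Algebra.algebraMap_eq_smul_one,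
    Algebra.algebraMap_eq_smul_one] at h
  exact le_of_smul_le_smul_of_nonneg_of_ne_zero zero_le_one one_ne_zero h

end StarProjection

/-! ### Operator monotone functions are concave -/

section Concavity

open InnerProductSpace in
/-- Two lines in a plane can be placed at any angle: if `p`, `v` are the projections onto the lines
spanned by unit vectors `e`, `w` with `|⟨e, w⟩|² = s`, then `p v p = s p`. The space lives in the
universe `u`, and `s` acts as a complex number, so that no real structure on the space enters. -/
theorem exists_isStarProjection_mul_mul_eq_smul {s : ℝ} (hs : 0 ≤ s) (hs' : s ≤ 1) :
    ∃ (E : Type u) (_ : NormedAddCommGroup E) (_ : InnerProductSpace ℂ E) (_ : CompleteSpace E)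
      (p v : E →L[ℂ] E),
      IsStarProjection p ∧ IsStarProjection v ∧ p ≠ 0 ∧ p * v * p = (s : ℂ) • p := by
  let e : EuclideanSpace ℂ (ULift.{u} (Fin 2)) := EuclideanSpace.single ⟨0⟩ 1
  let e' : EuclideanSpace ℂ (ULift.{u} (Fin 2)) := EuclideanSpace.single ⟨1⟩ 1
  have he : ‖e‖ = 1 := by simp [e]
  have he' : ‖e'‖ = 1 := by simp [e']
  have hee' : inner ℂ e e' = 0 := by
    simp [e, e', EuclideanSpace.inner_single_left]
  have hee : inner ℂ e e = 1 := by simp [inner_self_eq_norm_sq_to_K, he]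
  let v : EuclideanSpace ℂ (ULift.{u} (Fin 2)) := (√s : ℂ) • e + (√(1 - s) : ℂ) • e'
  have hv : ‖v‖ = 1 := by
    have h : ‖v‖ ^ 2 = 1 := by
      have h0 := @norm_add_sq ℂ _ _ _ _ ((√s : ℂ) • e) ((√(1 - s) : ℂ) • e')
      simp only [inner_smul_left, inner_smul_right, hee', norm_smul, he, he'] at h0
      rw [h0]
      simp [Real.sq_sqrt hs, Real.sq_sqrt (sub_nonneg.2 hs')]
    nlinarith [norm_nonneg v]
  have hev : inner ℂ e v = (√s : ℂ) := by
    simp only [v, inner_add_right, inner_smul_right, hee, hee', mul_one, mul_zero, add_zero]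
  have hve : inner ℂ v e = (√s : ℂ) := by
    rw [← inner_conj_symm, hev, Complex.conj_ofReal]
  refine ⟨EuclideanSpace ℂ (ULift.{u} (Fin 2)), inferInstance, inferInstance, inferInstance,
    rankOne ℂ e e, rankOne ℂ v v,
    isStarProjection_rankOne_self he, isStarProjection_rankOne_self hv,
    rankOne_ne_zero ?_ ?_, ?_⟩
  iterate 2 exact norm_ne_zero_iff.1 (by simp [he])
  · have hss : (√s : ℂ) * (√s : ℂ) = s := by exact_mod_cast Real.mul_self_sqrt hs
    ext1 x
    simp only [mul_apply_eq_comp, rankOne_apply, inner_smul_right, hev, hve,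
      _root_.smul_apply]
    rw [mul_assoc, hss, mul_comm, mul_smul]

namespace IsPositiveOperatorMonotone

variable {f : ℝ → ℝ}

theorem le_of_le (hf : IsPositiveOperatorMonotone.{u} f) {s t : ℝ} (hs : 0 < s) (hst : s ≤ t) :
    f s ≤ f t := by
  obtain ⟨E, _, _, _, p, -, -, -, hp0, -⟩ :=
    exists_isStarProjection_mul_mul_eq_smul.{u} (s := 0) le_rfl zero_le_one
  have : Nontrivial (E →L[ℂ] E) := ⟨p, 0, hp0⟩
  exact le_of_cfc_monotone (hf.monotone E) hs hst

theorem combo_le_apply_mul (hf : IsPositiveOperatorMonotone.{u} f) {a b s δ : ℝ} (ha : 0 < a)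
    (hb : 0 < b) (hs : 0 ≤ s) (hs' : s ≤ 1) (hδ : 0 < δ) :
    s * f a + (1 - s) * f b ≤ f ((1 + δ) * (s * a + (1 - s) * b)) := by
  obtain ⟨E, _, _, _, p, v, hp, hv, hp0, hpv⟩ := exists_isStarProjection_mul_mul_eq_smul.{u} hs hs'
  exact combo_le_apply_mul_of_cfc_monotone (hf.monotone E) hp hv hp0 ha hb hpv hδ

theorem concaveOn (hf : IsPositiveOperatorMonotone.{u} f) : ConcaveOn ℝ (Set.Ioi 0) f := by
  refine ⟨convex_Ioi 0, fun a ha b hb s r hs hr hsr => ?_⟩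
  obtain rfl : r = 1 - s := by linarith
  have hmem : s • a + (1 - s) • b ∈ Set.Ioi (0 : ℝ) := convex_Ioi 0 ha hb hs hr hsr
  simp only [smul_eq_mul] at hmem ⊢
  have hcont : ContinuousAt f ((1 + 0) * (s * a + (1 - s) * b)) := by
    rw [add_zero, one_mul]
    exact hf.continuousOn.continuousAt (Ioi_mem_nhds hmem)
  have hlim : Filter.Tendsto (fun δ : ℝ => f ((1 + δ) * (s * a + (1 - s) * b)))
      (nhdsWithin 0 (Set.Ioi 0)) (nhds (f (s * a + (1 - s) * b))) := by
    have h : ContinuousAt (fun δ : ℝ => f ((1 + δ) * (s * a + (1 - s) * b))) 0 :=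
      ContinuousAt.comp (f := fun δ : ℝ => (1 + δ) * (s * a + (1 - s) * b)) hcont (by fun_prop)
    simpa [ContinuousAt] using h.tendsto.mono_left nhdsWithin_le_nhds
  refine ge_of_tendsto hlim ?_
  filter_upwards [self_mem_nhdsWithin] with δ hδ
  exact hf.combo_le_apply_mul ha hb hs (by linarith) hδ

/-- A positive concave function on the half-line has `f x / x` decreasing: bound the chord from
`ε` to `t` below and let `ε → 0`. -/
theorem mul_apply_le_mul_apply (hf : IsPositiveOperatorMonotone.{u} f) {s t : ℝ} (hs : 0 < s)
    (hst : s ≤ t) : s * f t ≤ t * f s := by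
  have ht : 0 < t := hs.trans_le hst
  rcases hst.eq_or_lt with rfl | hlt
  · rfl
  have key : ∀ ε ∈ Set.Ioo 0 s, (s - ε) * f t ≤ (t - ε) * f s := by
    intro ε hε
    have h := hf.concaveOn.slope_anti_adjacent (x := ε) hε.1 ht hε.2 hlt
    have hpos := hf.pos ε hε.1
    rw [div_le_div_iff₀ (by linarith) (by linarith [hε.2])] at h
    have := hε.2
    nlinarith [mul_pos hpos (sub_pos.2 hlt)]
  have h1 : Filter.Tendsto (fun ε : ℝ => (s - ε) * f t) (nhdsWithin 0 (Set.Ioi 0))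
      (nhds ((s - 0) * f t)) :=
    Filter.Tendsto.mono_left (Continuous.tendsto (by fun_prop) 0) nhdsWithin_le_nhds
  have h2 : Filter.Tendsto (fun ε : ℝ => (t - ε) * f s) (nhdsWithin 0 (Set.Ioi 0))
      (nhds ((t - 0) * f s)) :=
    Filter.Tendsto.mono_left (Continuous.tendsto (by fun_prop) 0) nhdsWithin_le_nhds
  rw [sub_zero] at h1 h2
  refine le_of_tendsto_of_tendsto h1 h2 ?_
  filter_upwards [Ioo_mem_nhdsGT hs] with ε hε using key ε hε

end IsPositiveOperatorMonotone
end Concavity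

/-! ### Chords of concave functions -/

section Chord

variable {f : ℝ → ℝ} {a b : ℝ}

theorem chord_eq_combo (hab : a < b) (t : ℝ) :
    chordSlope f a b * t + chordIntercept f a b =
      (b - t) / (b - a) * f a + (t - a) / (b - a) * f b := by
  have : b - a ≠ 0 := (sub_pos.2 hab).ne'
  unfold chordSlope chordIntercept
  field_simp
  ring

theorem chord_pos (hab : a < b) (ha : 0 < f a) (hb : 0 < f b) {t : ℝ} (ht : t ∈ Set.Icc a b) :
    0 < chordSlope f a b * t + chordIntercept f a b := by
  have hba := sub_pos.2 hab
  rw [chord_eq_combo hab]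
  rcases ht.1.eq_or_lt with rfl | h
  · simpa [hba.ne'] using ha
  · exact add_pos_of_nonneg_of_pos
      (mul_nonneg (div_nonneg (sub_nonneg.2 ht.2) hba.le) ha.le)
      (mul_pos (div_pos (sub_pos.2 h) hba) hb)

theorem chord_le_of_concaveOn {s : Set ℝ} (hf : ConcaveOn ℝ s f) (ha : a ∈ s) (hb : b ∈ s)
    (hab : a < b) {t : ℝ} (ht : t ∈ Set.Icc a b) :
    chordSlope f a b * t + chordIntercept f a b ≤ f t := by
  have hba := sub_pos.2 hab
  rw [chord_eq_combo hab]
  have h := hf.2 ha hb (div_nonneg (sub_nonneg.2 ht.2) hba.le)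
    (div_nonneg (sub_nonneg.2 ht.1) hba.le) (by field_simp; ring)
  have ht : (b - t) / (b - a) * a + (t - a) / (b - a) * b = t := by
    have := hba.ne'
    field_simp
    ring
  simpa only [smul_eq_mul, ht] using h

end Chord

/-! ### Estimates for operator means -/

section OperatorMean

variable {H : Type u} [NormedAddCommGroup H] [InnerProductSpace ℂ H] [CompleteSpace H]

theorem spectrum_subset_Icc {X : H →L[ℂ] H} {c d : ℝ} (hX : IsSelfAdjoint X)
    (hc : c • (1 : H →L[ℂ] H) ≤ X) (hd : X ≤ d • (1 : H →L[ℂ] H)) :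
    spectrum ℝ X ⊆ Set.Icc c d := by
  have h1 : ∀ x ∈ spectrum ℝ X, c ≤ x :=
    (algebraMap_le_iff_le_spectrum (a := X)).1 (by rwa [Algebra.algebraMap_eq_smul_one])
  have h2 : ∀ x ∈ spectrum ℝ X, x ≤ d :=
    (le_algebraMap_iff_spectrum_le (a := X)).1 (by rwa [Algebra.algebraMap_eq_smul_one])
  exact fun x hx => ⟨h1 x hx, h2 x hx⟩

theorem isSelfAdjoint_of_smul_one_le {X : H →L[ℂ] H} {c : ℝ} (hc : 0 < c)
    (h : c • (1 : H →L[ℂ] H) ≤ X) : IsSelfAdjoint X :=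
  (isStrictlyPositive_of_smul_one_le hc h).isSelfAdjoint

theorem rpow_half_mul_self {A : H →L[ℂ] H} (hA : IsStrictlyPositive A) :
    A ^ (1 / 2 : ℝ) * A ^ (1 / 2 : ℝ) = A := by
  rw [← CFC.rpow_add hA.isUnit, add_halves, CFC.rpow_one A hA.nonneg]

theorem rpow_neg_half_mul_rpow_half {A : H →L[ℂ] H} (hA : IsStrictlyPositive A) :
    A ^ (-1 / 2 : ℝ) * A ^ (1 / 2 : ℝ) = 1 := by
  rw [neg_div]; exact CFC.rpow_neg_mul_rpow _ hA

theorem rpow_half_mul_rpow_neg_half {A : H →L[ℂ] H} (hA : IsStrictlyPositive A) :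
    A ^ (1 / 2 : ℝ) * A ^ (-1 / 2 : ℝ) = 1 := by
  rw [neg_div]; exact CFC.rpow_mul_rpow_neg _ hA

theorem rpow_half_conj_rpow_neg_half_conj {A : H →L[ℂ] H} (hA : IsStrictlyPositive A)
    (B : H →L[ℂ] H) :
    A ^ (1 / 2 : ℝ) * (A ^ (-1 / 2 : ℝ) * B * A ^ (-1 / 2 : ℝ)) * A ^ (1 / 2 : ℝ) = B := by
  rw [mul_assoc (A ^ (-1 / 2 : ℝ)), ← mul_assoc, rpow_half_mul_rpow_neg_half hA, one_mul,
    mul_assoc, rpow_neg_half_mul_rpow_half hA, mul_one]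

/-- Conjugation by `A ^ (1 / 2)` turns affine functions of `A ^ (-1 / 2) * B * A ^ (-1 / 2)` into
linear combinations of `A` and `B`. -/
theorem operatorMean_affine {A B : H →L[ℂ] H} (hA : IsStrictlyPositive A) (hB : 0 ≤ B) (μ ν : ℝ) :
    operatorMean (fun t => μ * t + ν) A B = μ • B + ν • A := by
  have hX : IsSelfAdjoint (A ^ (-1 / 2 : ℝ) * B * A ^ (-1 / 2 : ℝ)) :=
    .of_nonneg (conjugate_nonneg_of_nonneg hB CFC.rpow_nonneg)
  unfold operatorMean
  rw [cfc_add_const .., cfc_const_mul_id .., Algebra.algebraMap_eq_smul_one, mul_add, add_mul,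
    mul_smul_comm, smul_mul_assoc, rpow_half_conj_rpow_neg_half_conj hA, mul_smul_comm, mul_one,
    smul_mul_assoc, rpow_half_mul_self hA]

theorem operatorMean_le_operatorMean {f g : ℝ → ℝ} {A B : H →L[ℂ] H}
    (hf : ContinuousOn f (spectrum ℝ (A ^ (-1 / 2 : ℝ) * B * A ^ (-1 / 2 : ℝ))))
    (hg : ContinuousOn g (spectrum ℝ (A ^ (-1 / 2 : ℝ) * B * A ^ (-1 / 2 : ℝ))))
    (h : ∀ t ∈ spectrum ℝ (A ^ (-1 / 2 : ℝ) * B * A ^ (-1 / 2 : ℝ)), f t ≤ g t) :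
    operatorMean f A B ≤ operatorMean g A B :=
  conjugate_le_conjugate_of_nonneg (cfc_mono h) CFC.rpow_nonneg

theorem smul_one_le_rpow_neg_half_conj {A B : H →L[ℂ] H} {c d : ℝ} (hA : IsStrictlyPositive A)
    (hc : 0 ≤ c) (hd : 0 < d) (hAd : A ≤ d • (1 : H →L[ℂ] H)) (hB : c • (1 : H →L[ℂ] H) ≤ B) :
    (c / d) • (1 : H →L[ℂ] H) ≤ A ^ (-1 / 2 : ℝ) * B * A ^ (-1 / 2 : ℝ) := by
  have h : (c / d) • A ≤ B := by
    refine le_trans ?_ hB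
    have := smul_le_smul_of_nonneg_left hAd (div_nonneg hc hd.le)
    rwa [smul_smul, div_mul_cancel₀ _ hd.ne'] at this
  have := conjugate_le_conjugate_of_nonneg h (CFC.rpow_nonneg (a := A) (y := -1 / 2))
  rwa [mul_smul_comm, smul_mul_assoc, neg_div, CFC.conjugate_rpow_neg_one_half A hA,
    ← neg_div] at this

theorem rpow_neg_half_conj_le_smul_one {A B : H →L[ℂ] H} {c d : ℝ} (hA : IsStrictlyPositive A)
    (hc : 0 ≤ c) (hd : 0 < d) (hAd : d • (1 : H →L[ℂ] H) ≤ A) (hB : B ≤ c • (1 : H →L[ℂ] H)) :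
    A ^ (-1 / 2 : ℝ) * B * A ^ (-1 / 2 : ℝ) ≤ (c / d) • (1 : H →L[ℂ] H) := by
  have h : B ≤ (c / d) • A := by
    refine hB.trans ?_
    have := smul_le_smul_of_nonneg_left hAd (div_nonneg hc hd.le)
    rwa [smul_smul, div_mul_cancel₀ _ hd.ne'] at this
  have := conjugate_le_conjugate_of_nonneg h (CFC.rpow_nonneg (a := A) (y := -1 / 2))
  rwa [mul_smul_comm, smul_mul_assoc, neg_div, CFC.conjugate_rpow_neg_one_half A hA,
    ← neg_div] at this

/-- The mean of `A` with a scalar is a function of `A` alone. -/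
theorem operatorMean_smul_one {f : ℝ → ℝ} (hf : ContinuousOn f (Set.Ioi 0)) {A : H →L[ℂ] H}
    (hA : IsStrictlyPositive A) {c : ℝ} (hc : 0 < c) :
    operatorMean f A (c • 1) = cfc (fun t => t * f (c / t)) A := by
  have hpos : ∀ t ∈ spectrum ℝ A, 0 < t := fun t ht => hA.spectrum_pos ht
  have hsa : IsSelfAdjoint A := hA.isSelfAdjoint
  have hrpow (y : ℝ) : ContinuousOn (fun t : ℝ => t ^ y) (spectrum ℝ A) :=
    fun t ht => (Real.continuousAt_rpow_const _ _ (.inl (hpos t ht).ne')).continuousWithinAt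
  have hX : A ^ (-1 / 2 : ℝ) * (c • 1) * A ^ (-1 / 2 : ℝ) = cfc (fun t : ℝ => c / t) A := by
    rw [mul_smul_comm, mul_one, smul_mul_assoc, ← CFC.rpow_add hA.isUnit,
      CFC.rpow_eq_cfc_real hA.nonneg, ← cfc_const_mul _ _ _ (hrpow _)]
    refine cfc_congr fun t ht => ?_
    norm_num [Real.rpow_neg_one, div_eq_mul_inv]
  have hdiv : ContinuousOn (fun t : ℝ => c / t) (spectrum ℝ A) :=
    continuousOn_const.div continuousOn_id fun t ht => (hpos t ht).ne'
  have hfd : ContinuousOn (fun t : ℝ => f (c / t)) (spectrum ℝ A) :=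
    hf.comp hdiv fun t ht => div_pos hc (hpos t ht)
  unfold operatorMean
  rw [hX, ← cfc_comp' f (fun t : ℝ => c / t) A
      (hf.mono (Set.image_subset_iff.2 fun t ht => div_pos hc (hpos t ht))) hdiv,
    CFC.rpow_eq_cfc_real hA.nonneg, ← cfc_mul _ _ _ (hrpow _) hfd,
    ← cfc_mul (fun t : ℝ => t ^ (1 / 2 : ℝ) * f (c / t)) _ _ ((hrpow _).mul hfd) (hrpow _)]
  refine cfc_congr fun t ht => ?_
  have ht0 := hpos t ht
  have : t ^ (1 / 2 : ℝ) * t ^ (1 / 2 : ℝ) = t := by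
    rw [← Real.rpow_add ht0, add_halves, Real.rpow_one]
  linear_combination f (c / t) * this

variable {f : ℝ → ℝ} {A B : H →L[ℂ] H} {a₁ b₁ a₂ b₂ : ℝ}

theorem spectrum_rpow_neg_half_conj_subset_Icc (ha₁ : 0 < a₁) (hab₁ : a₁ ≤ b₁) (ha₂ : 0 < a₂)
    (hab₂ : a₂ ≤ b₂)
    (hA : a₁ • (1 : H →L[ℂ] H) ≤ A) (hA' : A ≤ b₁ • (1 : H →L[ℂ] H))
    (hB : a₂ • (1 : H →L[ℂ] H) ≤ B) (hB' : B ≤ b₂ • (1 : H →L[ℂ] H)) :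
    spectrum ℝ (A ^ (-1 / 2 : ℝ) * B * A ^ (-1 / 2 : ℝ)) ⊆ Set.Icc (a₂ / b₁) (b₂ / a₁) := by
  have hAp := isStrictlyPositive_of_smul_one_le ha₁ hA
  have hlow := smul_one_le_rpow_neg_half_conj hAp ha₂.le (ha₁.trans_le hab₁) hA' hB
  exact spectrum_subset_Icc
    (isSelfAdjoint_of_smul_one_le (div_pos ha₂ (ha₁.trans_le hab₁)) hlow) hlow
    (rpow_neg_half_conj_le_smul_one hAp (ha₂.le.trans hab₂) ha₁ hA hB')

theorem operatorMean_mono_right (hf : IsPositiveOperatorMonotone.{u} f) {B' : H →L[ℂ] H}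
    (hA : IsStrictlyPositive A) (hB : IsStrictlyPositive B) (hBB' : B ≤ B') :
    operatorMean f A B ≤ operatorMean f A B' := by
  have hunit : IsUnit (A ^ (-1 / 2 : ℝ)) := (hA.rpow A _).isUnit
  refine conjugate_le_conjugate_of_nonneg (hf.monotone H _ _ ?_ ?_) CFC.rpow_nonneg
  · exact IsStrictlyPositive.iff_of_unital.2
      ⟨conjugate_nonneg_of_nonneg hB.nonneg CFC.rpow_nonneg, (hunit.mul hB.isUnit).mul hunit⟩
  · exact conjugate_le_conjugate_of_nonneg hBB' CFC.rpow_nonneg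

theorem IsPositiveOperatorMonotone.mul_apply_div_le (hf : IsPositiveOperatorMonotone.{u} f)
    {c s t : ℝ} (hc : 0 < c) (hs : 0 < s) (hst : s ≤ t) : s * f (c / s) ≤ t * f (c / t) := by
  have ht := hs.trans_le hst
  have h := hf.mul_apply_le_mul_apply (div_pos hc ht) (div_le_div_of_nonneg_left hc.le hs hst)
  rw [div_mul_eq_mul_div, div_mul_eq_mul_div, div_le_div_iff₀ ht hs] at h
  exact le_of_mul_le_mul_left (by linarith) hc

theorem continuousOn_mul_apply_div (hf : ContinuousOn f (Set.Ioi 0)) {c : ℝ} (hc : 0 < c)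
    {s : Set ℝ} (hs : ∀ t ∈ s, 0 < t) : ContinuousOn (fun t => t * f (c / t)) s :=
  continuousOn_id.mul (hf.comp (continuousOn_const.div continuousOn_id fun t ht => (hs t ht).ne')
    fun t ht => div_pos hc (hs t ht))

theorem smul_one_le_operatorMean (hf : IsPositiveOperatorMonotone.{u} f) (ha₁ : 0 < a₁)
    (ha₂ : 0 < a₂) (hA : a₁ • (1 : H →L[ℂ] H) ≤ A) (hB : a₂ • (1 : H →L[ℂ] H) ≤ B) :
    (a₁ * f (a₂ / a₁)) • (1 : H →L[ℂ] H) ≤ operatorMean f A B := by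
  have hAp := isStrictlyPositive_of_smul_one_le ha₁ hA
  have hsa : IsSelfAdjoint A := hAp.isSelfAdjoint
  refine le_trans ?_
    (operatorMean_mono_right hf hAp (isStrictlyPositive_of_smul_one_le ha₂ le_rfl) hB)
  rw [operatorMean_smul_one hf.continuousOn hAp ha₂, ← Algebra.algebraMap_eq_smul_one]
  refine algebraMap_le_cfc _ _ _ (fun t ht => hf.mul_apply_div_le ha₂ ha₁ ?_)
    (continuousOn_mul_apply_div hf.continuousOn ha₂ fun t ht => hAp.spectrum_pos ht)
  exact (algebraMap_le_iff_le_spectrum (a := A)).1 (by rwa [Algebra.algebraMap_eq_smul_one]) t ht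

theorem operatorMean_le_smul_one (hf : IsPositiveOperatorMonotone.{u} f) (hb₂ : 0 < b₂)
    (hA : IsStrictlyPositive A) (hB : IsStrictlyPositive B)
    (hA' : A ≤ b₁ • (1 : H →L[ℂ] H)) (hB' : B ≤ b₂ • (1 : H →L[ℂ] H)) :
    operatorMean f A B ≤ (b₁ * f (b₂ / b₁)) • (1 : H →L[ℂ] H) := by
  have hsa : IsSelfAdjoint A := hA.isSelfAdjoint
  refine (operatorMean_mono_right hf hA hB hB').trans ?_
  rw [operatorMean_smul_one hf.continuousOn hA hb₂, ← Algebra.algebraMap_eq_smul_one]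
  refine cfc_le_algebraMap _ _ _
    (fun t ht => hf.mul_apply_div_le hb₂ (hA.spectrum_pos ht) ?_)
    (continuousOn_mul_apply_div hf.continuousOn hb₂ fun t ht => hA.spectrum_pos ht)
  exact (le_algebraMap_iff_spectrum_le (a := A)).1 (by rwa [Algebra.algebraMap_eq_smul_one]) t ht

/-- Comparison of squares: `P ^ 2 ≤ (M + m) P - m M ≤ α (M + m) Q - m M ≤ β Q ^ 2`. -/
theorem sq_le_smul_sq {P Q : H →L[ℂ] H} {m M α β : ℝ} (hm : 0 < m) (hmM : m ≤ M)
    (hmP : m • (1 : H →L[ℂ] H) ≤ P) (hPM : P ≤ M • (1 : H →L[ℂ] H))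
    (hmQ : m • (1 : H →L[ℂ] H) ≤ Q) (hQM : Q ≤ M • (1 : H →L[ℂ] H)) (hPQ : P ≤ α • Q)
    (hβ : ∀ t ∈ Set.Icc m M, squaringRatio α m M t ≤ β) : P ^ 2 ≤ β • Q ^ 2 := by
  have hP := isSelfAdjoint_of_smul_one_le hm hmP
  have hQ := isSelfAdjoint_of_smul_one_le hm hmQ
  have h1 : cfc (fun t : ℝ => t ^ 2) P ≤ cfc (fun t : ℝ => (M + m) * t + -(m * M)) P := by
    refine cfc_mono fun t ht => ?_
    obtain ⟨h1, h2⟩ := spectrum_subset_Icc hP hmP hPM ht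
    -- `(t - m) (M - t) ≥ 0`
    nlinarith [mul_nonneg (sub_nonneg.2 h1) (sub_nonneg.2 h2)]
  have h2 : cfc (fun t : ℝ => (α * (M + m)) * t + -(m * M)) Q ≤ cfc (fun t : ℝ => β * t ^ 2) Q := by
    refine cfc_mono fun t ht => ?_
    have hmem := spectrum_subset_Icc hQ hmQ hQM ht
    have h := hβ t hmem
    rw [squaringRatio, div_le_iff₀ (pow_pos (hm.trans_le hmem.1) 2)] at h
    linarith
  rw [cfc_add_const .., cfc_const_mul_id .., cfc_pow_id ..] at h1
  rw [cfc_add_const .., cfc_const_mul_id .., cfc_const_mul .., cfc_pow_id ..] at h2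
  refine h1.trans (le_trans ?_ h2)
  have h3 := smul_le_smul_of_nonneg_left hPQ (show 0 ≤ M + m by linarith)
  rw [smul_smul, mul_comm (M + m)] at h3
  exact add_le_add_left h3 _

end OperatorMean

theorem mainTheorem3 {H K : Type u}
    [NormedAddCommGroup H] [InnerProductSpace ℂ H] [CompleteSpace H]
    [NormedAddCommGroup K] [InnerProductSpace ℂ K] [CompleteSpace K]
    (Φ : (H →L[ℂ] H) →ₚ[ℂ] (K →L[ℂ] K)) (hΦ : Φ 1 = 1)
    (f : ℝ → ℝ) (hf : IsPositiveOperatorMonotone.{u} f)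
    (m₁ M₁ m₂ M₂ : ℝ) (hm₁ : 0 < m₁) (hM₁ : m₁ ≤ M₁) (hm₂ : 0 < m₂) (hM₂ : m₂ ≤ M₂)
    (hne : m₁ < M₁ ∨ m₂ < M₂)
    (A B : H →L[ℂ] H)
    (hA : m₁ ^ 2 • (1 : H →L[ℂ] H) ≤ A) (hA' : A ≤ M₁ ^ 2 • (1 : H →L[ℂ] H))
    (hB : m₂ ^ 2 • (1 : H →L[ℂ] H) ≤ B) (hB' : B ≤ M₂ ^ 2 • (1 : H →L[ℂ] H)) :
    ∃ α β : ℝ,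
      IsGreatest (chordRatio f (m₂ ^ 2 / M₁ ^ 2) (M₂ ^ 2 / m₁ ^ 2) ''
        Set.Icc (m₂ ^ 2 / M₁ ^ 2) (M₂ ^ 2 / m₁ ^ 2)) α ∧
      IsGreatest (squaringRatio α (m₁ ^ 2 * f (m₂ ^ 2 / m₁ ^ 2)) (M₁ ^ 2 * f (M₂ ^ 2 / M₁ ^ 2)) ''
        Set.Icc (m₁ ^ 2 * f (m₂ ^ 2 / m₁ ^ 2)) (M₁ ^ 2 * f (M₂ ^ 2 / M₁ ^ 2))) β ∧
      operatorMean f (Φ A) (Φ B) ^ 2 ≤ β • Φ (operatorMean f A B) ^ 2 := by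
  have hM₁0 : 0 < M₁ := hm₁.trans_le hM₁
  have hM₂0 : 0 < M₂ := hm₂.trans_le hM₂
  have ha₁ : 0 < m₁ ^ 2 := by positivity
  have ha₂ : 0 < m₂ ^ 2 := by positivity
  have hb₁ : 0 < M₁ ^ 2 := by positivity
  have hb₂ : 0 < M₂ ^ 2 := by positivity
  have hab₁ : m₁ ^ 2 ≤ M₁ ^ 2 := by gcongr
  have hab₂ : m₂ ^ 2 ≤ M₂ ^ 2 := by gcongr
  have hab : m₂ ^ 2 / M₁ ^ 2 < M₂ ^ 2 / m₁ ^ 2 := by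
    rw [div_lt_div_iff₀ hb₁ ha₁]
    rcases hne with h | h
    · exact mul_lt_mul' hab₂ (by gcongr) ha₁.le hb₂
    · exact mul_lt_mul (by gcongr) hab₁ ha₁ hb₂.le
  -- From here on the bounds enter only through their squares.
  generalize m₁ ^ 2 = a₁, m₂ ^ 2 = a₂, M₁ ^ 2 = b₁, M₂ ^ 2 = b₂ at *
  clear hm₁ hm₂ hM₁ hM₂ hM₁0 hM₂0 hne
  set a := a₂ / b₁
  set b := b₂ / a₁
  have ha : 0 < a := div_pos ha₂ hb₁
  have hb : 0 < b := div_pos hb₂ ha₁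
  have hIcc : Set.Icc a b ⊆ Set.Ioi 0 := fun t ht => ha.trans_le ht.1
  have hchord : ∀ t ∈ Set.Icc a b, 0 < chordSlope f a b * t + chordIntercept f a b :=
    fun t ht => chord_pos hab (hf.pos a ha) (hf.pos b hb) ht
  have hfc : ContinuousOn f (Set.Icc a b) := hf.continuousOn.mono hIcc
  obtain ⟨α, hα⟩ := (isCompact_Icc.image_of_continuousOn
    (f := chordRatio f a b) (hfc.div (by fun_prop) fun t ht => (hchord t ht).ne')).exists_isGreatest
    ((Set.nonempty_Icc.2 hab.le).image _)
  set m := a₁ * f (a₂ / a₁)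
  set M := b₁ * f (b₂ / b₁)
  have hm : 0 < m := mul_pos ha₁ (hf.pos _ (div_pos ha₂ ha₁))
  have hmM : m ≤ M := (hf.mul_apply_div_le ha₂ ha₁ hab₁).trans
    (mul_le_mul_of_nonneg_left (hf.le_of_le ha (by gcongr)) hb₁.le)
  obtain ⟨β, hβ⟩ := (isCompact_Icc.image_of_continuousOn (s := Set.Icc m M)
    (f := squaringRatio α m M) (ContinuousOn.div (by fun_prop) (by fun_prop)
      fun t ht => (pow_pos (hm.trans_le ht.1) 2).ne')).exists_isGreatest
    ((Set.nonempty_Icc.2 hmM).image _)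
  refine ⟨α, β, hα, hβ, ?_⟩
  have hΦs (c : ℝ) : Φ (c • (1 : H →L[ℂ] H)) = c • (1 : K →L[ℂ] K) := by
    rw [PositiveLinearMap.map_smul_of_tower, hΦ]
  have hΦA : a₁ • (1 : K →L[ℂ] K) ≤ Φ A := hΦs a₁ ▸ OrderHomClass.mono Φ hA
  have hΦA' : Φ A ≤ b₁ • (1 : K →L[ℂ] K) := hΦs b₁ ▸ OrderHomClass.mono Φ hA'
  have hΦB : a₂ • (1 : K →L[ℂ] K) ≤ Φ B := hΦs a₂ ▸ OrderHomClass.mono Φ hB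
  have hΦB' : Φ B ≤ b₂ • (1 : K →L[ℂ] K) := hΦs b₂ ▸ OrderHomClass.mono Φ hB'
  have hAp := isStrictlyPositive_of_smul_one_le ha₁ hA
  have hBp := isStrictlyPositive_of_smul_one_le ha₂ hB
  have hΦAp := isStrictlyPositive_of_smul_one_le ha₁ hΦA
  have hΦBp := isStrictlyPositive_of_smul_one_le ha₂ hΦB
  have hspec := spectrum_rpow_neg_half_conj_subset_Icc ha₁ hab₁ ha₂ hab₂ hA hA' hB hB'
  have hspecΦ := spectrum_rpow_neg_half_conj_subset_Icc ha₁ hab₁ ha₂ hab₂ hΦA hΦA' hΦB hΦB'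
  have hlow : chordSlope f a b • B + chordIntercept f a b • A ≤ operatorMean f A B := by
    rw [← operatorMean_affine hAp hBp.nonneg]
    exact operatorMean_le_operatorMean (by fun_prop) (hfc.mono hspec)
      fun t ht => chord_le_of_concaveOn hf.concaveOn ha hb hab (hspec ht)
  have hup : operatorMean f (Φ A) (Φ B) ≤
      (α * chordSlope f a b) • Φ B + (α * chordIntercept f a b) • Φ A := by
    rw [← operatorMean_affine hΦAp hΦBp.nonneg]
    refine operatorMean_le_operatorMean (hfc.mono hspecΦ) (by fun_prop) fun t ht => ?_
    have h : f t / _ ≤ α := hα.2 (Set.mem_image_of_mem _ (hspecΦ ht))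
    rw [div_le_iff₀ (hchord t (hspecΦ ht))] at h
    linarith
  have hα0 : 0 ≤ α := by
    have h : f a / _ ≤ α := hα.2 (Set.mem_image_of_mem _ (Set.left_mem_Icc.2 hab.le))
    exact (div_pos (hf.pos a ha) (hchord a (Set.left_mem_Icc.2 hab.le))).le.trans h
  have hPQ : operatorMean f (Φ A) (Φ B) ≤ α • Φ (operatorMean f A B) := by
    refine hup.trans ?_
    have h := smul_le_smul_of_nonneg_left (OrderHomClass.mono Φ hlow) hα0
    rwa [map_add, PositiveLinearMap.map_smul_of_tower, PositiveLinearMap.map_smul_of_tower,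
      smul_add, smul_smul, smul_smul] at h
  refine sq_le_smul_sq hm hmM (smul_one_le_operatorMean hf ha₁ ha₂ hΦA hΦB)
    (operatorMean_le_smul_one hf hb₂ hΦAp hΦBp hΦA' hΦB') ?_ ?_ hPQ
    fun t ht => hβ.2 (Set.mem_image_of_mem _ ht)
  · exact hΦs m ▸ OrderHomClass.mono Φ (smul_one_le_operatorMean hf ha₁ ha₂ hA hB)
  · exact hΦs M ▸ OrderHomClass.mono Φ (operatorMean_le_smul_one hf hb₂ hAp hBp hA' hB')
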